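/- **Setting.** Let $\mathbb R\langle\mathbf x\rangle=\mathbb R\langle x_1,\dots,x_n\rangle$ be the algebra of polynomials in non-commuting variables, with the $\mathbb R$-linear involution $(x_{u_1}\cdots x_{u_k})^*=x_{u_k}\cdots x_{u_1}$. For a word $u=(u_1,\dots,u_k)$ write $x_u=x_{u_1}\cdots x_{u_k}$; let $z_1,\dots,z_n$ be non-commuting indeterminates that commute with the $x_i$. A *state* is a linear functional $\varphi:\mathbb R\langle\mathbf x\rangle\to\mathbb R$ with $\varphi[1]=1$ and $\varphi[A^*A]\ge 0$ for all $A$; it is *tracial* if $\varphi[ST]=\varphi[TS]$ for all $S,T$. With $M(\mathbf z)=\sum_{|u|\ge1}\varphi[x_u]z_u$, the *free cumulant generating function* $R_\varphi(\mathbf z)=\sum_{|u|\ge1}R_\varphi[x_u]z_u$ is the unique formal power series with $R_\varphi\bigl(z_1(1+M(\mathbf z)),\dots,z_n(1+M(\mathbf z))\bigr)=M(\mathbf z)$. All variables are assumed centered with unit covariance: $\varphi[x_i]=0$, $\varphi[x_ix_j]=\delta_{ij}$. The left derivative $D_i$ is the linear map on power series in $\mathbf z$ given by $D_i1=0$, $D_i(z_jz_u)=\delta_{ij}z_u$.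 A state $\varphi$ is a *free Meixner state* if, for $R=R_\varphi$ and the $n$-tuple $\mathbf U$ of power series, $U_i=z_i+$ higher-order terms, with $(D_iR)(\mathbf U(\mathbf z))=z_i$, the polynomials $P_u$ defined by $$\sum_u P_u(\mathbf x)z_u=\bigl(1-\mathbf x\cdot\mathbf U(\mathbf z)+R(\mathbf U(\mathbf z))\bigr)^{-1}$$ are orthogonal, i.e. $\varphi[P_u^*P_v]=0$ whenever $u\ne v$. For $b\in\mathbb R$, a state on $\mathbb R[x]$ whose free cumulant generating function satisfies $R(z)/z^2=1+b\,R(z)/z$ is called (standard) *semicircular* if $b=0$ and (centered, of unit variance) *free Poisson* if $b\neq0$. A unital functional on $\mathbb R\langle\mathbf y\rangle$ is the *free product* of functionals $\psi_1,\dots,\psi_n$ on $\mathbb R[y_1],\dots,\mathbb R[y_n]$ if its free cumulants satisfy $R[y_u]=0$ unless all letters of $u$ are equal, and $R[y_i^k]=R_{\psi_i}[y_i^k]$ for all $i,k$. **Proposition.** Let $\varphi$ be a tracial free Meixner state on $\mathbb R\langle x_1,\dots,x_n\rangle$ (centered, with unit covariance), and suppose that there are real numbers $B_{ij}^t$ with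 $$D_iD_jR_\varphi=\delta_{ij}+\sum_{t=1}^nB_{ij}^t\,D_tR_\varphi\qquad(1\le i,j\le n).$$ Then there is a rotation $O$ (an orthogonal $n\times n$ matrix with $\det O=1$) such that, for the change of variables $\mathbf x=O\mathbf y$, the functional that $\varphi$ induces on $\mathbb R\langle\mathbf y\rangle$ (that is, the joint distribution of $y_j=\sum_iO_{ij}x_i$ under $\varphi$) is the free product of states $\psi_1,\dots,\psi_n$, each of which is semicircular or free Poisson. -/

import Mathlib

noncomputable section

/-! ### Formal power series in non-commuting indeterminates -/

/-- Formal power series in non-commuting indeterminates `z i`, `i : σ`, with coefficients in `A`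
(the coefficients commute with the indeterminates).  The value at the word `[u₁, …, u_k]` is the
coefficient of the monomial `z u₁ ⋯ z u_k`; the value at `[]` is the constant term. -/
def NCSeries (σ A : Type*) : Type _ := List σ → A

namespace NCSeries

variable {σ A : Type*}

instance [AddCommGroup A] : AddCommGroup (NCSeries σ A) :=
  inferInstanceAs (AddCommGroup (List σ → A))

instance [AddCommGroup A] [Module ℝ A] : Module ℝ (NCSeries σ A) :=
  inferInstanceAs (Module ℝ (List σ → A))

instance [Zero A] [One A] : One (NCSeries σ A) :=
  ⟨fun w => match w with
    | [] => 1
    | _ :: _ => 0⟩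

/-- Product of series: the coefficient of `z_w` in `f * g` is the sum of `f u * g v` over all
ways of writing the word `w` as a concatenation `u ++ v`. -/
instance [Semiring A] : Mul (NCSeries σ A) :=
  ⟨fun f g w => ∑ k ∈ Finset.range (w.length + 1), f (w.take k) * g (w.drop k)⟩

/-- The indeterminate `z i`. -/
def Z [DecidableEq σ] (i : σ) : NCSeries σ ℝ := fun w => if w = [i] then 1 else 0

/-- The left partial derivative `D i`: `D i 1 = 0` and `D i (z j * z_w) = δ_ij z_w`. -/
def D (i : σ) (f : NCSeries σ ℝ) : NCSeries σ ℝ := fun w => f (i :: w)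

/-- The product `V u₁ * ⋯ * V u_k` for the word `u = [u₁, …, u_k]`. -/
def wordProd (V : σ → NCSeries σ ℝ) : List σ → NCSeries σ ℝ
  | [] => 1
  | i :: u => V i * wordProd V u

/-- Substitution `f (V)`, i.e. `∑_u f u • (V u₁ * ⋯ * V u_k)`, for a tuple `V` of series
without constant term.  The words `u` longer than `w` do not contribute to the coefficient of
`z_w`, whence the finite sum. -/
def subst [Fintype σ] (f : NCSeries σ ℝ) (V : σ → NCSeries σ ℝ) : NCSeries σ ℝ :=
  fun w => ∑ k ∈ Finset.range (w.length + 1), ∑ u : Fin k → σ,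
    f (List.ofFn u) * wordProd V (List.ofFn u) w

end NCSeries

namespace FreeMeixner

open NCSeries

variable {σ : Type*}

/-! ### States on non-commutative polynomials -/

/-- A state on `ℝ⟨x⟩`: unital and positive.  The involution `star` of `FreeAlgebra ℝ σ` fixes the
variables, is `ℝ`-linear and reverses products. -/
def IsState (φ : FreeAlgebra ℝ σ →ₗ[ℝ] ℝ) : Prop :=
  φ 1 = 1 ∧ ∀ a : FreeAlgebra ℝ σ, 0 ≤ φ (star a * a)

def IsTracial (φ : FreeAlgebra ℝ σ →ₗ[ℝ] ℝ) : Prop :=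
  ∀ a b : FreeAlgebra ℝ σ, φ (a * b) = φ (b * a)

/-- The variables are centered with unit covariance. -/
def IsNormalized [DecidableEq σ] (φ : FreeAlgebra ℝ σ →ₗ[ℝ] ℝ) : Prop :=
  (∀ i, φ (FreeAlgebra.ι ℝ i) = 0) ∧
    ∀ i j, φ (FreeAlgebra.ι ℝ i * FreeAlgebra.ι ℝ j) = if i = j then 1 else 0

/-- The monomial `x u₁ ⋯ x u_k`. -/
def monomial (u : List σ) : FreeAlgebra ℝ σ := (u.map (FreeAlgebra.ι ℝ)).prod

/-- The moment generating function `M(z) = ∑_{|u| ≥ 1} φ[x_u] z_u`. -/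
def momentSeries (φ : FreeAlgebra ℝ σ →ₗ[ℝ] ℝ) : NCSeries σ ℝ := fun w =>
  match w with
  | [] => 0
  | i :: u => φ (monomial (i :: u))

/-- The relation that defines the free cumulant generating function `R` through the moment
generating function `M`: `R (z₁ (1 + M(z)), …, zₙ (1 + M(z))) = M(z)`. -/
def IsFreeCumulantSeries [Fintype σ] [DecidableEq σ] (φ : FreeAlgebra ℝ σ →ₗ[ℝ] ℝ)
    (R : NCSeries σ ℝ) : Prop :=
  R.subst (fun i => Z i * (1 + momentSeries φ)) = momentSeries φ

section Existence

theorem mul_apply' (f g : NCSeries σ ℝ) (w : List σ) :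
    (f * g) w = ∑ k ∈ Finset.range (w.length + 1), f (w.take k) * g (w.drop k) := rfl

theorem Z_mul_nil [DecidableEq σ] (i : σ) (f : NCSeries σ ℝ) : (Z i * f) [] = 0 := by
  simp [mul_apply', Z]

theorem Z_mul_singleton [DecidableEq σ] (i j : σ) (f : NCSeries σ ℝ) :
    (Z i * f) [j] = if j = i then f [] else 0 := by
  simp [mul_apply', Z, Finset.sum_range_succ]

theorem wordProd_of_le [DecidableEq σ] (V : σ → NCSeries σ ℝ) (h0 : ∀ i, V i [] = 0)
    (h1 : ∀ i j, V i [j] = if j = i then 1 else 0) (u : List σ) :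
    ∀ w : List σ, w.length ≤ u.length → wordProd V u w = if w = u then 1 else 0 := by
  induction u with
  | nil =>
    intro w hw
    have : w = [] := by simpa using hw
    subst this
    simp only [wordProd, if_true]
    rfl
  | cons i u ih =>
    intro w hw
    simp only [wordProd, mul_apply']
    cases w with
    | nil => simp [h0]
    | cons j w =>
      have hw' : w.length ≤ u.length := by simpa using hw
      rw [Finset.sum_eq_single 1]
      · simp only [List.take_succ_cons, List.take_zero, h1, List.drop_succ_cons, List.drop_zero,
          ih w hw', List.cons.injEq]
        split_ifs <;> simp_all
      · intro k hk hk1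
        rcases k with _ | _ | k
        · simp [h0]
        · simp at hk1
        · have hk' : k + 1 ≤ w.length := by
            simp only [Finset.mem_range, List.length_cons] at hk; omega
          have hl : (w.drop (k + 1)).length < u.length := by
            rw [List.length_drop]; omega
          rw [List.drop_succ_cons, ih _ hl.le, if_neg, mul_zero]
          intro h
          rw [h] at hl
          exact lt_irrefl _ hl
      · intro h
        simp at h

theorem subst_apply_top [Fintype σ] [DecidableEq σ] (R : NCSeries σ ℝ) (V : σ → NCSeries σ ℝ)
    (h0 : ∀ i, V i [] = 0) (h1 : ∀ i j, V i [j] = if j = i then 1 else 0) (w : List σ) :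
    R.subst V w = (∑ k ∈ Finset.range w.length, ∑ u : Fin k → σ,
      R (List.ofFn u) * wordProd V (List.ofFn u) w) + R w := by
  unfold NCSeries.subst
  rw [Finset.sum_range_succ]
  congr 1
  rw [Finset.sum_eq_single w.get]
  · rw [List.ofFn_get, wordProd_of_le V h0 h1 w w le_rfl, if_pos rfl, mul_one]
  · intro u _ hu
    rw [wordProd_of_le V h0 h1 _ _ (by simp), if_neg, mul_zero]
    intro h
    apply hu
    apply List.ofFn_injective
    rw [List.ofFn_get, ← h]
  · intro h
    simp at h

/-- Recursive solution of `R.subst V = M` for `V i = z i + higher-order terms`. -/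
def solveSubst [Fintype σ] (M : NCSeries σ ℝ) (V : σ → NCSeries σ ℝ) (w : List σ) : ℝ :=
  M w - ∑ k : Fin w.length, ∑ u : Fin k → σ,
    solveSubst M V (List.ofFn u) * wordProd V (List.ofFn u) w
termination_by w.length
decreasing_by
  rw [List.length_ofFn]
  exact k.2

theorem existsUnique_freeCumulantSeries [Fintype σ] [DecidableEq σ]
    (φ : FreeAlgebra ℝ σ →ₗ[ℝ] ℝ) : ∃! R : NCSeries σ ℝ, IsFreeCumulantSeries φ R := by
  have h0 : ∀ i : σ, (Z i * (1 + momentSeries φ)) [] = 0 := fun i => Z_mul_nil i _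
  have h1 : ∀ i j : σ, (Z i * (1 + momentSeries φ)) [j] = if j = i then 1 else 0 := by
    intro i j
    rw [Z_mul_singleton]
    have : (1 + momentSeries φ) [] = 1 := add_zero (1 : ℝ)
    rw [this]
  refine ⟨solveSubst (momentSeries φ) (fun i => Z i * (1 + momentSeries φ)), ?_, ?_⟩
  · funext w
    refine (subst_apply_top _ _ h0 h1 w).trans ?_
    rw [solveSubst, Finset.sum_range]
    ring
  · intro R hR
    have key : ∀ (m : ℕ) (w : List σ), w.length = m →
        R w = solveSubst (momentSeries φ) (fun i => Z i * (1 + momentSeries φ)) w := by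
      intro m
      induction m using Nat.strong_induction_on with
      | _ m ih =>
        intro w hw
        have h := congrFun hR w
        rw [subst_apply_top _ _ h0 h1, Finset.sum_range] at h
        rw [solveSubst, ← h, add_comm, eq_sub_iff_add_eq]
        congr 1
        refine Finset.sum_congr rfl fun k _ => Finset.sum_congr rfl fun u _ => ?_
        rw [ih k (hw ▸ k.2) (List.ofFn u) (by simp)]
    funext w
    exact key _ w rfl

end Existence

/-- The free cumulant generating function `R_φ`; its coefficient at the word `u` is the free
cumulant `R_φ[x_u]`. -/
def freeCumulantSeries [Fintype σ] [DecidableEq σ] (φ : FreeAlgebra ℝ σ →ₗ[ℝ] ℝ) :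
    NCSeries σ ℝ :=
  (existsUnique_freeCumulantSeries φ).choose

theorem freeCumulantSeries_spec [Fintype σ] [DecidableEq σ] (φ : FreeAlgebra ℝ σ →ₗ[ℝ] ℝ) :
    IsFreeCumulantSeries φ (freeCumulantSeries φ) :=
  (existsUnique_freeCumulantSeries φ).choose_spec.1

/-! ### Free Meixner states -/

/-- A family of polynomials indexed by words is orthogonal with respect to `φ`. -/
def IsOrthogonalFamily (φ : FreeAlgebra ℝ σ →ₗ[ℝ] ℝ) (P : List σ → FreeAlgebra ℝ σ) : Prop :=
  ∀ u v : List σ, u ≠ v → φ (star (P u) * P v) = 0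

/-- The series `1 - x · U(z) + R(U(z))` in `z` with coefficients in `ℝ⟨x⟩`. -/
def resolventDenom [Fintype σ] (R : NCSeries σ ℝ) (U : σ → NCSeries σ ℝ) :
    NCSeries σ (FreeAlgebra ℝ σ) := fun w =>
  (1 : NCSeries σ (FreeAlgebra ℝ σ)) w - ∑ i, U i w • FreeAlgebra.ι ℝ i
    + algebraMap ℝ (FreeAlgebra ℝ σ) (R.subst U w)

/-- A free Meixner state.  With `R` the free cumulant generating function of `φ` and `U` the
inverse of the tuple `(D i R)` under composition, `U i = z i + higher-order terms` and
`(D i R)(U(z)) = z i`, the polynomials `P_u` defined by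
`∑_u P_u(x) z_u = (1 - x · U(z) + R(U(z)))⁻¹` are orthogonal with respect to `φ`. -/
def IsFreeMeixnerState [Fintype σ] [DecidableEq σ] (φ : FreeAlgebra ℝ σ →ₗ[ℝ] ℝ) : Prop :=
  IsState φ ∧
  ∃ (U : σ → NCSeries σ ℝ) (P : NCSeries σ (FreeAlgebra ℝ σ)),
    (∀ i, U i [] = 0) ∧ (∀ i j, U i [j] = if i = j then 1 else 0) ∧
    (∀ i, (D i (freeCumulantSeries φ)).subst U = Z i) ∧
    P * resolventDenom (freeCumulantSeries φ) U = 1 ∧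
    resolventDenom (freeCumulantSeries φ) U * P = 1 ∧
    IsOrthogonalFamily φ P

/-! ### One variable -/

/-- A functional on `ℝ[x]`, viewed on non-commutative polynomials in a single variable. -/
def oneVar (ψ : Polynomial ℝ →ₗ[ℝ] ℝ) : FreeAlgebra ℝ Unit →ₗ[ℝ] ℝ :=
  ψ ∘ₗ (FreeAlgebra.lift ℝ (fun _ : Unit => (Polynomial.X : Polynomial ℝ))).toLinearMap

/-- The free cumulant generating function `∑_k R_ψ[x^k] z^k` of a functional on `ℝ[x]`. -/
def cumulantSeries (ψ : Polynomial ℝ →ₗ[ℝ] ℝ) : PowerSeries ℝ :=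
  PowerSeries.mk fun k => freeCumulantSeries (oneVar ψ) (List.replicate k ())

/-- `ψ` is the one-dimensional free Meixner state with parameters `b`, `c`: a state on `ℝ[x]`
(unital and positive) with `R(z) / z² = 1 + b R(z) / z + c (R(z) / z)²`. -/
def IsMeixnerDistribution (b c : ℝ) (ψ : Polynomial ℝ →ₗ[ℝ] ℝ) : Prop :=
  (ψ 1 = 1 ∧ ∀ p : Polynomial ℝ, 0 ≤ ψ (p * p)) ∧
  cumulantSeries ψ = PowerSeries.X ^ 2 + PowerSeries.C b * PowerSeries.X * cumulantSeries ψ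
    + PowerSeries.C c * cumulantSeries ψ ^ 2

/-- The (standard) semicircular distribution: `b = c = 0`, that is `R(z) = z²`. -/
def IsSemicircular (ψ : Polynomial ℝ →ₗ[ℝ] ℝ) : Prop := IsMeixnerDistribution 0 0 ψ

/-- A (centered, unit variance) free Poisson distribution: `c = 0` and `b ≠ 0`, that is
`R(z) = z² / (1 - b z)`. -/
def IsFreePoisson (ψ : Polynomial ℝ →ₗ[ℝ] ℝ) : Prop := ∃ b : ℝ, b ≠ 0 ∧ IsMeixnerDistribution b 0 ψ

/-! ### Free products and changes of variables -/

/-- `φ` is the free product of the functionals `ψ i`: it is unital, its mixed free cumulants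
vanish, and `R_φ[x_i^k] = R_{ψ i}[x^k]`. -/
def IsFreeProduct [Fintype σ] [DecidableEq σ] (φ : FreeAlgebra ℝ σ →ₗ[ℝ] ℝ)
    (ψ : σ → Polynomial ℝ →ₗ[ℝ] ℝ) : Prop :=
  φ 1 = 1 ∧
  (∀ u : List σ, (∃ i ∈ u, ∃ j ∈ u, i ≠ j) → freeCumulantSeries φ u = 0) ∧
  ∀ (i : σ) (k : ℕ), freeCumulantSeries φ (List.replicate k i) =
    freeCumulantSeries (oneVar (ψ i)) (List.replicate k ())

/-- The functional induced by `φ` on `ℝ⟨y⟩` for the change of variables `x = O y` with `O`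
orthogonal, so that `y = Oᵀ x`: `y j` is evaluated at `∑ i, O i j • x i`. -/
def changeVar [Fintype σ] (O : Matrix σ σ ℝ) (φ : FreeAlgebra ℝ σ →ₗ[ℝ] ℝ) :
    FreeAlgebra ℝ σ →ₗ[ℝ] ℝ :=
  φ ∘ₗ (FreeAlgebra.lift ℝ (fun j : σ => ∑ i, O i j • FreeAlgebra.ι ℝ i)).toLinearMap

end FreeMeixner

end

/-! The hypothesis is a closed recursion for the free cumulants, hence for the moments
(`D_momentSeries`, `HasStructure.derivSeries_cons`). It gives `φ[x_j x_a x_b] = B b a j`, while a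
fourth moment is two noncrossing pairings plus a contraction of `B` with itself. Traciality makes
`B` cyclic, and orthogonality of the `P_u` makes it reversal invariant, so `B` is a fully symmetric
tensor. Traciality of the fourth moments then says exactly that the symmetric matrices `B t` commute
(`HasStructure.sum_commute`).

A rotation `O` therefore diagonalizes all the `B t` at once. Free cumulants are multilinear
(`freeCumulantSeries_linChange`), so the recursion passes to the rotated variables. Its tensor there
is symmetric, and diagonal in two indices, hence supported on `(i, i, i)`: the recursion becomes
`D_i D_j R = δ_ij (1 + b_i D_i R)`. This forces the mixed cumulants to vanish and gives the
semicircular or free Poisson equation for each `y_i`. The factors are the distributions of the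
self-adjoint elements `y_i`, which makes them states. -/

noncomputable section

/-! ### Left derivatives, products and substitution of series -/

namespace NCSeries

variable {σ τ : Type*}

theorem mul_nil {A : Type*} [Semiring A] (f g : NCSeries σ A) : (f * g) [] = f [] * g [] := by
  simp [HMul.hMul, Mul.mul]

/-- The left derivative of a series with arbitrary coefficients. -/
def shift {A : Type*} (j : σ) (f : NCSeries σ A) : NCSeries σ A := fun v => f (j :: v)

theorem shift_apply {A : Type*} (j : σ) (f : NCSeries σ A) (w : List σ) :
    shift j f w = f (j :: w) := rfl

/-- Twisted Leibniz rule: the factorization with empty left factor is split off. It drives the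
inductions on words below. -/
theorem mul_cons {A : Type*} [Semiring A] (f g : NCSeries σ A) (j : σ) (w : List σ) :
    (f * g) (j :: w) = f [] * g (j :: w) + (shift j f * g) w := by
  change ∑ k ∈ Finset.range ((j :: w).length + 1), f ((j :: w).take k) * g ((j :: w).drop k) = _ +
    ∑ k ∈ Finset.range (w.length + 1), f (j :: w.take k) * g (w.drop k)
  rw [List.length_cons, Finset.sum_range_succ', add_comm]
  simp

theorem one_nil {A : Type*} [Zero A] [One A] : (1 : NCSeries σ A) [] = 1 := rfl

theorem one_cons {A : Type*} [Zero A] [One A] (j : σ) (w : List σ) :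
    (1 : NCSeries σ A) (j :: w) = 0 := rfl

theorem add_apply (f g : NCSeries σ ℝ) (w : List σ) : (f + g) w = f w + g w := rfl

theorem smul_apply (c : ℝ) (f : NCSeries σ ℝ) (w : List σ) : (c • f) w = c * f w := rfl

theorem zero_apply (w : List σ) : (0 : NCSeries σ ℝ) w = 0 := rfl

/-- The coefficient of `z_w`, as a linear functional. -/
def coeff (w : List σ) : NCSeries σ ℝ →ₗ[ℝ] ℝ where
  toFun f := f w
  map_add' _ _ := rfl
  map_smul' _ _ := rfl

theorem sum_apply {ι : Type*} (s : Finset ι) (f : ι → NCSeries σ ℝ) (w : List σ) :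
    (∑ i ∈ s, f i) w = ∑ i ∈ s, f i w :=
  map_sum (coeff w) f s

/-- The left partial derivative as a linear map. -/
def DLin (i : σ) : NCSeries σ ℝ →ₗ[ℝ] NCSeries σ ℝ where
  toFun := D i
  map_add' _ _ := rfl
  map_smul' _ _ := rfl

theorem D_apply (i : σ) (f : NCSeries σ ℝ) (w : List σ) : D i f w = f (i :: w) := rfl

theorem D_add (i : σ) (f g : NCSeries σ ℝ) : D i (f + g) = D i f + D i g := rfl

theorem D_smul (i : σ) (c : ℝ) (f : NCSeries σ ℝ) : D i (c • f) = c • D i f := rfl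

theorem D_sum {ι : Type*} (i : σ) (s : Finset ι) (f : ι → NCSeries σ ℝ) :
    D i (∑ k ∈ s, f k) = ∑ k ∈ s, D i (f k) :=
  map_sum (DLin i) f s

theorem D_one (i : σ) : D i (1 : NCSeries σ ℝ) = 0 := rfl

-- Bilinearity suffices; associativity of the product of series is never needed.
scoped instance : NonUnitalNonAssocSemiring (NCSeries σ ℝ) :=
  { (inferInstance : AddCommGroup (NCSeries σ ℝ)),
    (inferInstance : Mul (NCSeries σ ℝ)) with
    left_distrib := fun f g h => by
      funext w
      simp only [FreeMeixner.mul_apply', add_apply, mul_add, Finset.sum_add_distrib]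
    right_distrib := fun f g h => by
      funext w
      simp only [FreeMeixner.mul_apply', add_apply, add_mul, Finset.sum_add_distrib]
    zero_mul := fun f => by
      funext w
      simp only [FreeMeixner.mul_apply', zero_apply, zero_mul, Finset.sum_const_zero]
    mul_zero := fun f => by
      funext w
      simp only [FreeMeixner.mul_apply', zero_apply, mul_zero, Finset.sum_const_zero] }

instance : IsScalarTower ℝ (NCSeries σ ℝ) (NCSeries σ ℝ) :=
  ⟨fun c f g => by
    funext w
    simp only [smul_eq_mul, FreeMeixner.mul_apply', smul_apply, Finset.mul_sum, mul_assoc]⟩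

instance : SMulCommClass ℝ (NCSeries σ ℝ) (NCSeries σ ℝ) :=
  ⟨fun c f g => by
    funext w
    simp only [smul_eq_mul, FreeMeixner.mul_apply', smul_apply, Finset.mul_sum, mul_left_comm]⟩

theorem D_mul (f g : NCSeries σ ℝ) (j : σ) : D j (f * g) = f [] • D j g + D j f * g := by
  funext w
  exact mul_cons f g j w

protected theorem one_mul (f : NCSeries σ ℝ) : 1 * f = f := by
  funext w
  cases w with
  | nil => rw [mul_nil, one_nil, one_mul]
  | cons j w =>
    rw [mul_cons, one_nil, one_mul]
    change _ + (0 * f) w = _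
    rw [zero_mul, zero_apply, add_zero]

protected theorem mul_one (f : NCSeries σ ℝ) : f * 1 = f := by
  funext w
  induction w generalizing f with
  | nil => rw [mul_nil, one_nil, mul_one]
  | cons j w ih =>
    rw [mul_cons, one_cons, mul_zero, zero_add]
    exact ih _

/-- If `a` has no constant term, the coefficients of `a * g` involve only coefficients of `g` at
strictly shorter words. -/
theorem mul_congr_of_lt {a g h : NCSeries σ ℝ} (ha : a [] = 0) {w : List σ}
    (H : ∀ v : List σ, v.length < w.length → g v = h v) : (a * g) w = (a * h) w := by
  rw [FreeMeixner.mul_apply', FreeMeixner.mul_apply']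
  refine Finset.sum_congr rfl fun k hk => ?_
  rcases k with _ | k
  · simp [ha]
  · by_cases hw : w = []
    · subst hw
      simp [ha]
    · rw [H]
      have := List.length_pos_iff.2 hw
      rw [List.length_drop]
      omega

theorem wordProd_eq_zero (V : σ → NCSeries σ ℝ) (h0 : ∀ i, V i [] = 0) (u : List σ) :
    ∀ w : List σ, w.length < u.length → wordProd V u w = 0 := by
  induction u with
  | nil => intro w hw; simp at hw
  | cons i u ih =>
    intro w hw
    rw [wordProd, mul_congr_of_lt (h := 0) (h0 i), mul_zero, zero_apply]
    intro v hv
    rw [List.length_cons] at hw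
    exact ih v (by omega)

variable [Fintype σ]

/-- The cutoff is freed from the length of `w`, so that coefficients at words of different lengths
can share one sum. -/
theorem subst_eq_of_le (f : NCSeries σ ℝ) (V : σ → NCSeries σ ℝ) (h0 : ∀ i, V i [] = 0)
    (w : List σ) {N : ℕ} (hN : w.length ≤ N) :
    f.subst V w = ∑ k ∈ Finset.range (N + 1), ∑ u : Fin k → σ,
      f (List.ofFn u) * wordProd V (List.ofFn u) w := by
  refine Finset.sum_subset (Finset.range_mono (by omega)) fun k _ hk => ?_
  refine Finset.sum_eq_zero fun u _ => ?_
  rw [wordProd_eq_zero V h0 _ w, mul_zero]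
  rw [List.length_ofFn]
  simp only [Finset.mem_range] at hk
  omega

/-- A substitution is determined by the left derivatives. -/
theorem subst_eq (f : NCSeries σ ℝ) (V : σ → NCSeries σ ℝ) (h0 : ∀ i, V i [] = 0) :
    f.subst V = f [] • 1 + ∑ i, V i * (D i f).subst V := by
  funext w
  rw [add_apply, sum_apply, smul_apply, subst_eq_of_le f V h0 w (Nat.le_succ _),
    Finset.sum_range_succ', add_comm]
  congr 1
  · simp [wordProd]
  -- Since `V i` has no constant term, only words shorter than `w` enter, and the common cutoff
  -- `w.length` serves them all.
  · have key : ∀ i, (V i * (D i f).subst V) w =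
        (V i * ∑ k ∈ Finset.range (w.length + 1), ∑ u : Fin k → σ,
          f (i :: List.ofFn u) • wordProd V (List.ofFn u)) w := fun i => by
      refine mul_congr_of_lt (h0 i) fun v hv => ?_
      rw [subst_eq_of_le _ V h0 v hv.le]
      simp only [sum_apply, smul_apply, D_apply]
    simp only [key, Finset.mul_sum, sum_apply, mul_smul_comm, smul_apply]
    rw [Finset.sum_comm]
    refine Finset.sum_congr rfl fun k _ => ?_
    -- A word of length `k + 1` is its first letter together with a word of length `k`.
    rw [← Fintype.sum_prod_type', ← (Fin.consEquiv fun _ : Fin (k + 1) => σ).sum_comp]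
    refine Finset.sum_congr rfl fun u _ => ?_
    simp [Fin.consEquiv, wordProd]

theorem subst_nil (f : NCSeries σ ℝ) (V : σ → NCSeries σ ℝ) : f.subst V [] = f [] := by
  simp [subst, wordProd, one_nil]

/-- Substitution as a linear map. -/
def substLin (V : σ → NCSeries σ ℝ) : NCSeries σ ℝ →ₗ[ℝ] NCSeries σ ℝ where
  toFun f := f.subst V
  map_add' f g := by
    funext w
    simp only [subst, add_apply, add_mul, Finset.sum_add_distrib]
  map_smul' c f := by
    funext w
    simp only [subst, smul_apply, RingHom.id_apply, Finset.mul_sum, mul_assoc]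

theorem one_subst (V : σ → NCSeries σ ℝ) (h0 : ∀ i, V i [] = 0) :
    (1 : NCSeries σ ℝ).subst V = 1 := by
  rw [subst_eq _ V h0, one_nil, one_smul]
  have : ∀ i, (D i (1 : NCSeries σ ℝ)).subst V = 0 := fun i => map_zero (substLin V)
  simp [this]

/-! ### Linear substitutions -/

/-- The coefficients of the series obtained from a series by `z_i ↦ ∑_j O i j z_j`. -/
def linSubstCoeff (O : Matrix σ τ ℝ) : List τ → (NCSeries σ ℝ →ₗ[ℝ] ℝ)
  | [] => coeff []
  | j :: w => ∑ i, O i j • (linSubstCoeff O w ∘ₗ DLin i)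

/-- The linear substitution `z_i ↦ ∑_j O i j z_j`. -/
def linSubst (O : Matrix σ τ ℝ) : NCSeries σ ℝ →ₗ[ℝ] NCSeries τ ℝ where
  toFun f := fun w => linSubstCoeff O w f
  map_add' f g := by funext w; exact map_add _ f g
  map_smul' c f := by funext w; exact map_smul _ c f

theorem linSubst_nil (O : Matrix σ τ ℝ) (f : NCSeries σ ℝ) : linSubst O f [] = f [] := rfl

theorem D_linSubst (O : Matrix σ τ ℝ) (f : NCSeries σ ℝ) (j : τ) :
    D j (linSubst O f) = ∑ i, O i j • linSubst O (D i f) := by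
  funext w
  rw [sum_apply]
  change (∑ i, O i j • (linSubstCoeff O w ∘ₗ DLin i)) f = _
  rw [LinearMap.sum_apply]
  rfl

theorem linSubst_cons (O : Matrix σ τ ℝ) (f : NCSeries σ ℝ) (j : τ) (w : List τ) :
    linSubst O f (j :: w) = ∑ i, O i j * linSubst O (D i f) w := by
  have := congrFun (D_linSubst O f j) w
  rwa [D_apply, sum_apply] at this

theorem linSubst_one (O : Matrix σ τ ℝ) : linSubst O 1 = 1 := by
  funext w
  cases w with
  | nil => rfl
  | cons j w =>
    have : ∀ i, linSubst O (D i (1 : NCSeries σ ℝ)) = 0 := fun i => map_zero (linSubst O)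
    simp [linSubst_cons, this, zero_apply, one_cons]

theorem linSubst_mul (O : Matrix σ τ ℝ) (f g : NCSeries σ ℝ) :
    linSubst O (f * g) = linSubst O f * linSubst O g := by
  funext w
  induction w generalizing f with
  | nil => simp only [mul_nil, linSubst_nil]
  | cons j w ih =>
    change _ = D j (linSubst O f * linSubst O g) w
    rw [linSubst_cons, D_mul, D_linSubst, D_linSubst, Finset.sum_mul, Finset.smul_sum, add_apply,
      sum_apply, sum_apply, ← Finset.sum_add_distrib]
    refine Finset.sum_congr rfl fun i _ => ?_
    rw [D_mul, map_add, map_smul, add_apply, ih, smul_mul_assoc, linSubst_nil]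
    simp only [smul_apply]
    ring

theorem linSubst_Z [DecidableEq σ] [Fintype τ] [DecidableEq τ] (O : Matrix σ τ ℝ) (i : σ) :
    linSubst O (Z i) = ∑ a, O i a • Z a := by
  funext w
  cases w with
  | nil => simp [linSubst_nil, sum_apply, smul_apply, Z]
  | cons j w =>
    have h : ∀ k, D k (Z i) = if k = i then 1 else 0 := fun k => by
      funext v
      cases v <;> by_cases hk : k = i <;> simp [D_apply, Z, hk, one_nil, one_cons, zero_apply]
    have h' : ∀ k, linSubst O (D k (Z i)) = if k = i then 1 else 0 := fun k => by
      rw [h]; split_ifs <;> simp [linSubst_one]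
    rw [linSubst_cons]
    simp only [h', sum_apply, smul_apply, Z]
    cases w with
    | nil => simp [apply_ite (fun f : NCSeries τ ℝ => f []), one_nil, zero_apply]
    | cons b w => simp [apply_ite (fun f : NCSeries τ ℝ => f (b :: w)), one_cons, zero_apply]

/-- Expanding both sides by `subst_eq` gives the same recursion, in which vanishing constant terms
leave only shorter words. -/
theorem linSubst_subst [Fintype τ] (O : Matrix σ τ ℝ) (f : NCSeries σ ℝ) (V : σ → NCSeries σ ℝ)
    (V' : τ → NCSeries τ ℝ) (h0 : ∀ i, V i [] = 0) (h0' : ∀ a, V' a [] = 0)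
    (hV : ∀ i, linSubst O (V i) = ∑ a, O i a • V' a) :
    linSubst O (f.subst V) = (linSubst O f).subst V' := by
  funext w
  induction hn : w.length using Nat.strong_induction_on generalizing f w with
  | _ n ih =>
    subst hn
    rw [subst_eq f V h0, subst_eq _ V' h0', map_add, map_smul, linSubst_one, linSubst_nil,
      add_apply, add_apply, map_sum, sum_apply]
    congr 1
    have h1 : ∀ i, linSubst O (V i * (D i f).subst V) w =
        (linSubst O (V i) * (linSubst O (D i f)).subst V') w := fun i => by
      rw [linSubst_mul]
      exact mul_congr_of_lt (by rw [linSubst_nil, h0]) fun v hv => ih _ hv _ _ rfl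
    have h2 : ∀ a, (D a (linSubst O f)).subst V' =
        ∑ i, O i a • (linSubst O (D i f)).subst V' := fun a => by
      rw [D_linSubst]
      exact (map_sum (substLin V') _ _).trans
        (Finset.sum_congr rfl fun i _ => map_smul (substLin V') _ _)
    simp only [h1, h2, hV, Finset.sum_mul, Finset.mul_sum, sum_apply, smul_mul_assoc,
      mul_smul_comm, smul_apply]
    exact Finset.sum_comm

end NCSeries

/-! ### Monomials and low moments -/

namespace FreeMeixner

open NCSeries

variable {σ τ : Type*}

theorem star_smul_freeAlgebra (c : ℝ) (a : FreeAlgebra ℝ σ) : star (c • a) = c • star a := by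
  rw [Algebra.smul_def, star_mul, FreeAlgebra.star_algebraMap, Algebra.smul_def,
    Algebra.commutes]

theorem monomial_nil : monomial ([] : List σ) = 1 := rfl

theorem monomial_cons (i : σ) (u : List σ) :
    monomial (i :: u) = FreeAlgebra.ι ℝ i * monomial u := by
  simp [monomial]

theorem momentSeries_nil (φ : FreeAlgebra ℝ σ →ₗ[ℝ] ℝ) : momentSeries φ [] = 0 := rfl

theorem momentSeries_cons (φ : FreeAlgebra ℝ σ →ₗ[ℝ] ℝ) (i : σ) (u : List σ) :
    momentSeries φ (i :: u) = φ (FreeAlgebra.ι ℝ i * monomial u) := by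
  rw [← monomial_cons]
  rfl

theorem IsNormalized.momentSeries_singleton [DecidableEq σ] {φ : FreeAlgebra ℝ σ →ₗ[ℝ] ℝ}
    (hφ : IsNormalized φ) (i : σ) :
    momentSeries φ [i] = 0 := by
  rw [momentSeries_cons, monomial_nil, mul_one, hφ.1]

theorem IsNormalized.momentSeries_pair [DecidableEq σ] {φ : FreeAlgebra ℝ σ →ₗ[ℝ] ℝ}
    (hφ : IsNormalized φ) (i j : σ) :
    momentSeries φ [i, j] = if i = j then 1 else 0 := by
  rw [momentSeries_cons, monomial_cons, monomial_nil, mul_one, hφ.2]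

theorem IsTracial.momentSeries_rotate {φ : FreeAlgebra ℝ σ →ₗ[ℝ] ℝ} (htr : IsTracial φ) (i : σ)
    (u : List σ) :
    momentSeries φ (i :: u) = φ (monomial (u ++ [i])) := by
  rw [momentSeries_cons, htr]
  simp [monomial]

theorem D_Z_mul [DecidableEq σ] (i j : σ) (f : NCSeries σ ℝ) :
    D j (Z i * f) = if i = j then f else 0 := by
  have h : D j (Z i) = if i = j then 1 else 0 := by
    funext v
    cases v <;> by_cases hk : i = j <;>
      simp [D_apply, Z, hk, one_nil, one_cons, NCSeries.zero_apply, @eq_comm _ j i]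
  have h0 : Z i [] = 0 := by simp [Z]
  rw [D_mul, h, h0, zero_smul, zero_add]
  split_ifs
  · rw [NCSeries.one_mul]
  · rw [zero_mul]

theorem D_Z_mul_mul [DecidableEq σ] (i j : σ) (f g : NCSeries σ ℝ) :
    D j (Z i * f * g) = if i = j then f * g else 0 := by
  rw [D_mul, D_Z_mul, Z_mul_nil, zero_smul, zero_add, ite_mul, zero_mul]

/-! ### Free cumulants under linear changes of variables -/

section LinearChange

variable [Fintype σ]

/-- The joint distribution of the linear forms `∑ i, O i j • x i`. -/
def linChange (O : Matrix σ τ ℝ) (φ : FreeAlgebra ℝ σ →ₗ[ℝ] ℝ) : FreeAlgebra ℝ τ →ₗ[ℝ] ℝ :=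
  φ ∘ₗ (FreeAlgebra.lift ℝ (fun j : τ => ∑ i, O i j • FreeAlgebra.ι ℝ i)).toLinearMap

/-- The functional `L` is arbitrary because removing the first letter replaces it by `L (x_i * ·)`.
-/
theorem linSubst_monomial (O : Matrix σ τ ℝ) (L : FreeAlgebra ℝ σ →ₗ[ℝ] ℝ) (w : List τ) :
    linSubst O (show NCSeries σ ℝ from fun u => L (monomial u)) w = linChange O L (monomial w) := by
  induction w generalizing L with
  | nil => rw [linSubst_nil, monomial_nil, linChange]; simp [monomial_nil]
  | cons j w ih =>
    rw [linSubst_cons, monomial_cons, linChange]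
    simp only [LinearMap.comp_apply, AlgHom.toLinearMap_apply, map_mul, FreeAlgebra.lift_ι_apply,
      Finset.sum_mul, map_sum, smul_mul_assoc, map_smul, smul_eq_mul]
    refine Finset.sum_congr rfl fun i _ => ?_
    congr 1
    refine Eq.trans ?_ (ih (L ∘ₗ LinearMap.mulLeft ℝ (FreeAlgebra.ι ℝ i)))
    congr 2

theorem linSubst_momentSeries (O : Matrix σ τ ℝ) (φ : FreeAlgebra ℝ σ →ₗ[ℝ] ℝ) :
    linSubst O (momentSeries φ) = momentSeries (linChange O φ) := by
  funext w
  cases w with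
  | nil => rfl
  | cons j w =>
    have : momentSeries (linChange O φ) (j :: w) = linChange O φ (monomial (j :: w)) := rfl
    rw [this, ← linSubst_monomial, linSubst_cons, linSubst_cons]
    rfl

/-- The substituted series solves the equation defining the new cumulants, whose solution is unique.
Rectangular `O` covers both the rotation and the law of a single linear form. -/
theorem freeCumulantSeries_linChange [DecidableEq σ] [Fintype τ] [DecidableEq τ]
    (O : Matrix σ τ ℝ) (φ : FreeAlgebra ℝ σ →ₗ[ℝ] ℝ) :
    freeCumulantSeries (linChange O φ) = linSubst O (freeCumulantSeries φ) := by
  refine (existsUnique_freeCumulantSeries (linChange O φ)).unique (freeCumulantSeries_spec _) ?_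
  rw [IsFreeCumulantSeries, ← linSubst_momentSeries]
  conv_rhs => rw [← freeCumulantSeries_spec φ]
  refine (linSubst_subst O _ _ _ (fun i => Z_mul_nil i _) (fun i => Z_mul_nil i _) fun i => ?_).symm
  rw [linSubst_mul, linSubst_Z, map_add, linSubst_one, Finset.sum_mul]
  exact Finset.sum_congr rfl fun a _ => smul_mul_assoc _ _ _

end LinearChange

/-! ### Symmetry and commutation of the structure constants -/

section Moments

variable [Fintype σ] [DecidableEq σ]

/-- The series `(D j R) (z₁ (1 + M), …, zₙ (1 + M))`. -/
def derivSeries (φ : FreeAlgebra ℝ σ →ₗ[ℝ] ℝ) (j : σ) : NCSeries σ ℝ :=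
  (D j (freeCumulantSeries φ)).subst (fun i => Z i * (1 + momentSeries φ))

/-- In the expansion of `R(V)` by `subst_eq`, `V i` begins with `z i`, so `D j` keeps only the term
`i = j`. -/
theorem D_momentSeries (φ : FreeAlgebra ℝ σ →ₗ[ℝ] ℝ) (j : σ) :
    D j (momentSeries φ) = (1 + momentSeries φ) * derivSeries φ j := by
  have h := freeCumulantSeries_spec φ
  rw [IsFreeCumulantSeries, subst_eq _ _ (fun i => Z_mul_nil i _)] at h
  conv_lhs => rw [← h]
  rw [D_add, D_smul, D_sum, D_one, smul_zero, zero_add, Finset.sum_eq_single j]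
  · rw [D_Z_mul_mul, if_pos rfl]
    rfl
  · intro i _ hi
    rw [D_Z_mul_mul, if_neg hi]
  · simp

theorem derivSeries_nil (φ : FreeAlgebra ℝ σ →ₗ[ℝ] ℝ) (j : σ) :
    derivSeries φ j [] = momentSeries φ [j] := by
  have h := congrFun (D_momentSeries φ j) []
  rw [D_apply, mul_nil, NCSeries.add_apply, one_nil, momentSeries_nil, add_zero, one_mul] at h
  exact h.symm

/-- `D i D j R = δ i j + ∑ t, B t i j D t R`. -/
def HasStructure (φ : FreeAlgebra ℝ σ →ₗ[ℝ] ℝ) (B : σ → σ → σ → ℝ) : Prop :=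
  ∀ i j, D i (D j (freeCumulantSeries φ)) =
    (if i = j then 1 else 0) + ∑ t, B t i j • D t (freeCumulantSeries φ)

variable {φ : FreeAlgebra ℝ σ →ₗ[ℝ] ℝ} {B : σ → σ → σ → ℝ}

/-- The product of `1 + M` with `derivSeries φ t` folds back into `D t M`, so with `D_momentSeries`
this computes moments recursively. -/
theorem HasStructure.derivSeries_cons (hB : HasStructure φ B) (a j : σ) (w : List σ) :
    derivSeries φ j (a :: w) = (if a = j then (1 + momentSeries φ) w else 0) +
      ∑ t, B t a j * momentSeries φ (t :: w) := by
  set V : σ → NCSeries σ ℝ := fun i => Z i * (1 + momentSeries φ) with hV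
  have h0 : ∀ i, V i [] = 0 := fun i => Z_mul_nil i _
  have h1 : derivSeries φ j = (D j (freeCumulantSeries φ)) [] • 1 +
      ∑ i, V i * (D i (D j (freeCumulantSeries φ))).subst V := subst_eq _ V h0
  have h2 : (D a (D j (freeCumulantSeries φ))).subst V =
      (if a = j then 1 else 0) + ∑ t, B t a j • derivSeries φ t := by
    rw [hB]
    change substLin V _ = _
    rw [map_add, map_sum]
    congr 1
    · split_ifs
      · exact one_subst V h0
      · exact map_zero _
    · exact Finset.sum_congr rfl fun t _ => map_smul (substLin V) _ _
  have h3 : D a (derivSeries φ j) =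
      (1 + momentSeries φ) * (D a (D j (freeCumulantSeries φ))).subst V := by
    rw [h1, D_add, D_smul, D_sum, D_one, smul_zero, zero_add, Finset.sum_eq_single a]
    · rw [hV, D_Z_mul_mul, if_pos rfl]
    · intro i _ hi
      rw [hV, D_Z_mul_mul, if_neg hi]
    · simp
  change D a (derivSeries φ j) w = _
  rw [h3, h2, mul_add, Finset.mul_sum, NCSeries.add_apply, NCSeries.sum_apply]
  congr 1
  · split_ifs
    · rw [NCSeries.mul_one]
    · rw [mul_zero, NCSeries.zero_apply]
  · refine Finset.sum_congr rfl fun t _ => ?_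
    rw [mul_smul_comm, NCSeries.smul_apply, ← D_momentSeries, D_apply]

theorem HasStructure.momentSeries_three (hB : HasStructure φ B) (hφ : IsNormalized φ)
    (j a b : σ) : momentSeries φ [j, a, b] = B b a j := by
  have h := congrFun (D_momentSeries φ j) [a, b]
  simp only [D_apply, mul_cons, mul_nil, shift_apply] at h
  simpa [NCSeries.add_apply, one_nil, one_cons, momentSeries_nil,
    hφ.momentSeries_singleton, hφ.momentSeries_pair, derivSeries_nil, hB.derivSeries_cons] using h

theorem HasStructure.momentSeries_four (hB : HasStructure φ B) (hφ : IsNormalized φ)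
    (j a b c : σ) : momentSeries φ [j, a, b, c] = (if a = j then if b = c then 1 else 0 else 0) +
      (∑ t, B t a j * B c b t) + if c = j then if a = b then 1 else 0 else 0 := by
  have h := congrFun (D_momentSeries φ j) [a, b, c]
  simp only [D_apply, mul_cons, mul_nil, shift_apply] at h
  simpa [NCSeries.add_apply, one_nil, one_cons, momentSeries_nil,
    hφ.momentSeries_singleton, hφ.momentSeries_pair, derivSeries_nil, hB.derivSeries_cons,
    hB.momentSeries_three hφ] using h

theorem HasStructure.rotate (hB : HasStructure φ B) (hφ : IsNormalized φ) (htr : IsTracial φ)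
    (a b c : σ) : B c b a = B a c b := by
  rw [← hB.momentSeries_three hφ, ← hB.momentSeries_three hφ, htr.momentSeries_rotate]
  rfl

theorem HasStructure.sum_rotate (hB : HasStructure φ B) (hφ : IsNormalized φ) (htr : IsTracial φ)
    (j a b c : σ) : ∑ t, B t a j * B c b t = ∑ t, B t b a * B j c t := by
  have h : momentSeries φ [j, a, b, c] = momentSeries φ [a, b, c, j] := by
    rw [htr.momentSeries_rotate]
    rfl
  rw [hB.momentSeries_four hφ, hB.momentSeries_four hφ] at h
  simp only [@eq_comm _ b a, @eq_comm _ a j] at h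
  -- Rotation exchanges the two noncrossing pairings, so they cancel and only the contractions of
  -- `B` remain.
  have e : (if c = j then if a = b then (1 : ℝ) else 0 else 0) =
      if a = b then if c = j then 1 else 0 else 0 := by
    split_ifs <;> rfl
  linarith

theorem freeCumulantSeries_nil (φ : FreeAlgebra ℝ σ →ₗ[ℝ] ℝ) : freeCumulantSeries φ [] = 0 := by
  have h := congrFun (freeCumulantSeries_spec φ) []
  rwa [subst_nil, momentSeries_nil] at h

theorem IsNormalized.freeCumulantSeries_singleton (hφ : IsNormalized φ) (i : σ) :
    freeCumulantSeries φ [i] = 0 := by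
  have h := derivSeries_nil φ i
  rwa [derivSeries, subst_nil, D_apply, hφ.momentSeries_singleton] at h

/-- The orthogonality of `P_[t]` and `P_[a, b]` makes third moments invariant under reversal. -/
theorem IsFreeMeixnerState.momentSeries_reverse (hM : IsFreeMeixnerState φ) (hφ : IsNormalized φ)
    (t a b : σ) : momentSeries φ [t, a, b] = momentSeries φ [b, a, t] := by
  obtain ⟨hs, U, P, hU0, hU1, -, -, hQP, hP⟩ := hM
  set R := freeCumulantSeries φ with hR
  have q0 : resolventDenom R U [] = 1 := by
    simp [resolventDenom, hU0, subst_nil, hR, freeCumulantSeries_nil, one_nil]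
  have q1 : ∀ i, resolventDenom R U [i] = -FreeAlgebra.ι ℝ i := fun i => by
    have : R.subst U [i] = 0 := by
      rw [subst_eq _ _ hU0]
      simp [NCSeries.add_apply, sum_apply, NCSeries.smul_apply, one_cons, mul_apply',
        Finset.sum_range_succ, hU0, subst_nil, D_apply, hR, hφ.freeCumulantSeries_singleton]
    simp [resolventDenom, hU1, this, one_cons]
  have q2 : ∀ i j, resolventDenom R U [i, j] =
      - ∑ k, U k [i, j] • FreeAlgebra.ι ℝ k + algebraMap ℝ _ (R.subst U [i, j]) := fun i j => by
    simp [resolventDenom, one_cons]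
  have p0 : P [] = 1 := by
    have h := congrFun hQP []
    rwa [mul_nil, q0, one_nil, one_mul] at h
  have p1 : ∀ i, P [i] = FreeAlgebra.ι ℝ i := fun i => by
    have h := congrFun hQP [i]
    simp only [mul_cons, mul_nil, shift_apply, one_cons, q0, q1, p0, one_mul, mul_one] at h
    exact add_neg_eq_zero.1 h
  have p2 : P [a, b] = FreeAlgebra.ι ℝ a * FreeAlgebra.ι ℝ b +
      ∑ k, U k [a, b] • FreeAlgebra.ι ℝ k - algebraMap ℝ _ (R.subst U [a, b]) := by
    have h := congrFun hQP [a, b]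
    simp only [mul_cons, mul_nil, shift_apply, one_cons, q0, q1, q2, p0, p1, one_mul,
      mul_one, neg_mul] at h
    rw [← sub_eq_zero, ← h]
    abel
  -- Both orders are needed: positivity over `ℝ` does not give `φ (star x) = φ x`. Each third moment
  -- equals `-U t [a, b]`.
  have e1 := hP [t] [a, b] (by simp)
  have e2 := hP [a, b] [t] (by simp)
  rw [p1, p2] at e1 e2
  simp only [star_sub, star_add, star_mul, star_sum, star_smul_freeAlgebra, FreeAlgebra.star_ι,
    mul_sub, mul_add, sub_mul, add_mul, map_sub, map_add,
    Finset.mul_sum, Finset.sum_mul, map_sum, mul_smul_comm, smul_mul_assoc, map_smul, hφ.2,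
    Algebra.algebraMap_eq_smul_one, mul_one, one_mul, hφ.1, smul_eq_mul, star_one] at e1 e2
  simp only [momentSeries_cons, monomial_cons, monomial_nil, mul_one]
  simp only [mul_assoc, mul_ite, mul_one, mul_zero, Finset.sum_ite_eq,
    Finset.sum_ite_eq', Finset.mem_univ, if_true, sub_zero] at e1 e2
  linarith

theorem HasStructure.reverse (hB : HasStructure φ B) (hφ : IsNormalized φ)
    (hM : IsFreeMeixnerState φ) (a b c : σ) : B c b a = B a b c := by
  rw [← hB.momentSeries_three hφ, ← hB.momentSeries_three hφ, hM.momentSeries_reverse hφ]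

/-- By `sum_rotate`, both sides become `∑ t, B t b a * B i k t`, which is symmetric in `i` and `k`.
-/
theorem HasStructure.sum_commute (hB : HasStructure φ B) (hφ : IsNormalized φ)
    (htr : IsTracial φ) (hM : IsFreeMeixnerState φ) (i k a b : σ) :
    ∑ t, B i a t * B k t b = ∑ t, B k a t * B i t b := by
  have r := hB.rotate hφ htr
  have v := hB.reverse hφ hM
  have h1 := hB.sum_rotate hφ htr i a b k
  have h2 := hB.sum_rotate hφ htr k a b i
  -- Rotation and reversal generate all permutations of three indices.
  have s12 : ∀ x y z, B x y z = B y x z := fun x y z => (r z y x).trans (v y x z)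
  have s23 : ∀ x y z, B x y z = B x z y := fun x y z => (v z y x).trans (r x y z)
  have e1 : ∀ t, B i a t * B k t b = B t a i * B k b t := fun t => by rw [v t a i, s23 k t b]
  have e2 : ∀ t, B k a t * B i t b = B t a k * B i b t := fun t => by rw [v t a k, s23 i t b]
  simp_rw [e1, e2, h1, h2, s12 i k]

end Moments

end FreeMeixner

/-! ### Simultaneous diagonalization by a rotation -/

namespace Matrix

variable {ι : Type*} {n : ℕ}

/-- A commuting family of real symmetric matrices is simultaneously diagonalized by an orthogonal
matrix. -/
theorem exists_orthogonal_simultaneous_diagonal (A : ι → Matrix (Fin n) (Fin n) ℝ)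
    (hA : ∀ i, (A i).IsHermitian) (hC : ∀ i j, A i * A j = A j * A i) :
    ∃ O ∈ orthogonalGroup (Fin n) ℝ, ∃ d : ι → Fin n → ℝ, ∀ i, A i * O = O * diagonal (d i) := by
  classical
  let T : ι → EuclideanSpace ℝ (Fin n) →ₗ[ℝ] EuclideanSpace ℝ (Fin n) :=
    fun i => Matrix.toEuclideanLin (A i)
  have hT : ∀ i, (T i).IsSymmetric := fun i => isSymmetric_toEuclideanLin_iff.2 (hA i)
  have hTC : Pairwise (Function.onFun Commute T) := by
    intro i j _
    refine LinearMap.ext fun v => ?_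
    simp [T, toLpLin_apply, hC i j]
  have hI := DirectSum.isInternal_ne_bot_iff.2
    (LinearMap.IsSymmetric.directSum_isInternal_of_pairwise_commute hT hTC)
  have hO := LinearMap.IsSymmetric.orthogonalFamily_iInf_eigenspaces hT
  -- Joint eigenspaces are indexed by all of `ι → ℝ`; independence in finite dimension leaves
  -- finitely many nonzero ones.
  have hfin := WellFoundedGT.finite_ne_bot_of_iSupIndep hO.independent
  have : Fintype {χ : ι → ℝ // (⨅ j, Module.End.eigenspace (T j) (χ j)) ≠ ⊥} := hfin.fintype
  have hO' := hO.comp (Subtype.coe_injective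
    (p := fun χ : ι → ℝ => (⨅ j, Module.End.eigenspace (T j) (χ j)) ≠ ⊥))
  have hn : Module.finrank ℝ (EuclideanSpace ℝ (Fin n)) = n := by simp
  let b := hI.subordinateOrthonormalBasis hn hO'
  let χ := fun a => hI.subordinateOrthonormalBasisIndex hn a hO'
  have hb : ∀ i a, T i (b a) = (χ a).1 i • b a := fun i a => by
    have := hI.subordinateOrthonormalBasis_subordinate hn a hO'
    exact Module.End.mem_eigenspace_iff.1 ((Submodule.mem_iInf _).1 this i)
  -- The columns of `O` are the joint eigenvectors.
  refine ⟨Matrix.of fun i a => b a i, ?_, fun i a => (χ a).1 i, fun i => ?_⟩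
  · rw [mem_orthogonalGroup_iff']
    ext a c
    have := orthonormal_iff_ite.1 b.orthonormal c a
    rw [PiLp.inner_apply] at this
    simp only [mul_apply, of_apply, one_apply, @eq_comm _ a c]
    simpa using this
  · ext k a
    have h := congrArg (fun v : EuclideanSpace ℝ (Fin n) => v k) (hb i a)
    rw [mul_diagonal]
    simp only [T, toLpLin_apply, PiLp.smul_apply, smul_eq_mul] at h
    rw [of_apply, mul_comm, ← h]
    rfl

/-- The orthogonal matrix can be chosen to be a rotation. -/
theorem exists_rotation_simultaneous_diagonal (A : ι → Matrix (Fin n) (Fin n) ℝ)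
    (hA : ∀ i, (A i).IsHermitian) (hC : ∀ i j, A i * A j = A j * A i) :
    ∃ O ∈ specialOrthogonalGroup (Fin n) ℝ, ∃ d : ι → Fin n → ℝ,
      ∀ i, A i * O = O * diagonal (d i) := by
  obtain ⟨O, hO, d, hd⟩ := exists_orthogonal_simultaneous_diagonal A hA hC
  have hdet : O.det = 1 ∨ O.det = -1 := by
    have h := congrArg det ((mem_orthogonalGroup_iff _ _).1 hO)
    rw [det_mul, det_one, det_transpose] at h
    exact mul_self_eq_one_iff.1 h
  rcases hdet with h | h
  · exact ⟨O, mem_specialOrthogonalGroup_iff.2 ⟨hO, h⟩, d, hd⟩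
  · rcases n with _ | n
    · simp at h
      norm_num at h
    -- Negating the first column flips the determinant and keeps every column an eigenvector.
    · let s : Fin (n + 1) → ℝ := Function.update 1 0 (-1)
      have hs : ∀ a, s a * s a = 1 := fun a => by
        by_cases ha : a = 0 <;> simp [s, ha]
      refine ⟨O * diagonal s, mem_specialOrthogonalGroup_iff.2 ⟨?_, ?_⟩, d, fun i => ?_⟩
      · refine mul_mem hO ?_
        rw [mem_orthogonalGroup_iff, diagonal_transpose,
          diagonal_mul_diagonal]
        simp [hs]
      · rw [det_mul, h, det_diagonal, Fin.prod_univ_succ]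
        simp [s]
      · rw [← mul_assoc, hd, mul_assoc, mul_assoc, diagonal_mul_diagonal, diagonal_mul_diagonal]
        simp_rw [mul_comm]

end Matrix

/-! ### Marginal states and the diagonalized recursion -/

namespace FreeMeixner

open NCSeries

variable {σ : Type*}

/-- The distribution of an element. -/
def distribution (φ : FreeAlgebra ℝ σ →ₗ[ℝ] ℝ) (y : FreeAlgebra ℝ σ) : Polynomial ℝ →ₗ[ℝ] ℝ :=
  φ ∘ₗ (Polynomial.aeval y).toLinearMap

theorem star_aeval {y : FreeAlgebra ℝ σ} (hy : star y = y) (p : Polynomial ℝ) :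
    star (Polynomial.aeval y p) = Polynomial.aeval y p := by
  induction p using Polynomial.induction_on' with
  | add p q hp hq => rw [map_add, star_add, hp, hq]
  | monomial n c =>
    rw [Polynomial.aeval_monomial, star_mul, star_pow, hy, FreeAlgebra.star_algebraMap,
      Algebra.commutes]

/-- For self-adjoint `y`, `p(y)` is self-adjoint, so `p(y)²` has the form `star a * a`. -/
theorem IsState.distribution {φ : FreeAlgebra ℝ σ →ₗ[ℝ] ℝ} (hφ : IsState φ)
    {y : FreeAlgebra ℝ σ} (hy : star y = y) :
    distribution φ y 1 = 1 ∧ ∀ p : Polynomial ℝ, 0 ≤ distribution φ y (p * p) := by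
  refine ⟨by simp [FreeMeixner.distribution, hφ.1], fun p => ?_⟩
  have h := hφ.2 (Polynomial.aeval y p)
  rw [star_aeval hy] at h
  simpa [FreeMeixner.distribution] using h

variable [Fintype σ]

theorem oneVar_distribution (φ : FreeAlgebra ℝ σ →ₗ[ℝ] ℝ) (v : σ → ℝ) :
    oneVar (distribution φ (∑ i, v i • FreeAlgebra.ι ℝ i)) =
      linChange (Matrix.of fun i (_ : Unit) => v i) φ := by
  rw [oneVar, distribution, linChange, LinearMap.comp_assoc]
  congr 1
  rw [← AlgHom.comp_toLinearMap]
  congr 1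
  ext x
  simp

theorem linSubst_replicate {τ : Type*} (O : Matrix σ τ ℝ) (a : τ) (f : NCSeries σ ℝ) (k : ℕ) :
    linSubst (Matrix.of fun i (_ : Unit) => O i a) f (List.replicate k ()) =
      linSubst O f (List.replicate k a) := by
  induction k generalizing f with
  | zero => rfl
  | succ k ih => simp only [List.replicate_succ, linSubst_cons, ih, Matrix.of_apply]

theorem star_linearForm (v : σ → ℝ) :
    star (∑ i, v i • FreeAlgebra.ι ℝ i) = ∑ i, v i • FreeAlgebra.ι ℝ i := by
  simp [star_sum, star_smul_freeAlgebra]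

variable [DecidableEq σ]

/-- The cumulant recursion in coordinates that diagonalize the structure constants. -/
theorem HasStructure.diagonal {φ : FreeAlgebra ℝ σ →ₗ[ℝ] ℝ} {B : σ → σ → σ → ℝ}
    (hB : HasStructure φ B) (hs : ∀ x y z, B x y z = B y x z) {O : Matrix σ σ ℝ}
    (hO : O ∈ Matrix.orthogonalGroup σ ℝ) {d : σ → σ → ℝ}
    (hd : ∀ t, Matrix.of (B t) * O = O * Matrix.diagonal (d t)) :
    ∃ b : σ → ℝ, HasStructure (changeVar O φ)
      fun t i j => if i = j then if t = i then b i else 0 else 0 := by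
  have hOO : ∀ a c, ∑ i, O i a * O i c = if a = c then 1 else 0 := fun a c => by
    have h := congrFun (congrFun ((Matrix.mem_orthogonalGroup_iff' _ _).1 hO) a) c
    simpa [Matrix.mul_apply, Matrix.one_apply] using h
  have hOO' : ∀ s t, ∑ c, O s c * O t c = if s = t then 1 else 0 := fun s t => by
    have h := congrFun (congrFun ((Matrix.mem_orthogonalGroup_iff _ _).1 hO) s) t
    simpa [Matrix.mul_apply, Matrix.one_apply] using h
  have hBd : ∀ t a c, ∑ i, O i a * ∑ j, B t i j * O j c = if a = c then d t c else 0 :=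
    fun t a c => by
    have h1 : ∀ i, ∑ j, B t i j * O j c = O i c * d t c := fun i => by
      have h := congrFun (congrFun (hd t) i) c
      rwa [Matrix.mul_diagonal, Matrix.mul_apply] at h
    simp_rw [h1, ← mul_assoc, ← Finset.sum_mul, hOO, ite_mul, one_mul, zero_mul]
  -- The left side is the tensor `B` on columns `c, a, a` of `O`. Swapping its first two slots gives
  -- `a, c, a`, an off-diagonal entry that `hBd` kills when `c ≠ a`.
  have hdO : ∀ c a, ∑ t, O t c * d t a = if c = a then ∑ t, O t a * d t a else 0 := fun c a => by
    split_ifs with h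
    · rw [h]
    · have h1 : ∀ t, d t a = ∑ i, O i a * ∑ j, B t i j * O j a := fun t => by
        rw [hBd, if_pos rfl]
      calc ∑ t, O t c * d t a
          = ∑ i, O i a * ∑ t, O t c * ∑ j, B i t j * O j a := by
            simp_rw [h1, Finset.mul_sum]
            rw [Finset.sum_comm]
            refine Finset.sum_congr rfl fun i _ => Finset.sum_congr rfl fun t _ =>
              Finset.sum_congr rfl fun j _ => ?_
            rw [hs t i j]
            ring
        _ = 0 := by simp_rw [hBd, if_neg h, mul_zero, Finset.sum_const_zero]
  set R := freeCumulantSeries φ with hR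
  -- Orthogonality of `O` inverts the chain rule `D_linSubst`.
  have hDR : ∀ t, linSubst O (D t R) = ∑ c, O t c • D c (linSubst O R) := fun t => by
    simp_rw [D_linSubst, Finset.smul_sum, smul_smul]
    rw [Finset.sum_comm]
    simp_rw [← Finset.sum_smul, hOO', ite_smul, one_smul, zero_smul]
    simp
  refine ⟨fun a => ∑ t, O t a * d t a, fun a c => ?_⟩
  have hR' : freeCumulantSeries (changeVar O φ) = linSubst O R := freeCumulantSeries_linChange O φ
  rw [hR']
  have hδ : ∀ i j : σ, linSubst O (if i = j then 1 else 0) = (if i = j then 1 else 0 : ℝ) • 1 :=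
    fun i j => by split_ifs <;> simp [linSubst_one]
  calc D a (D c (linSubst O R))
      = ∑ j, ∑ i, (O i a * O j c) • linSubst O (D i (D j R)) := by
        rw [D_linSubst, D_sum]
        refine Finset.sum_congr rfl fun j _ => ?_
        rw [D_smul, D_linSubst, Finset.smul_sum]
        simp_rw [smul_smul, mul_comm]
    _ = (∑ i, O i a * ∑ j, (if i = j then 1 else 0) * O j c) • 1 +
          ∑ t, (∑ i, O i a * ∑ j, B t i j * O j c) • linSubst O (D t R) := by
        have hB' := hB
        rw [HasStructure] at hB'
        simp_rw [← hR] at hB'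
        simp_rw [hB', map_add, hδ, map_sum, map_smul, smul_add, Finset.sum_add_distrib,
          Finset.smul_sum, smul_smul, Finset.mul_sum, Finset.sum_smul]
        congr 1
        · rw [Finset.sum_comm]
          refine Finset.sum_congr rfl fun i _ => Finset.sum_congr rfl fun j _ => ?_
          congr 1
          ring
        · refine Finset.sum_comm.trans (Eq.trans ?_ Finset.sum_comm)
          refine Finset.sum_congr rfl fun i _ => Finset.sum_comm.trans ?_
          refine Finset.sum_congr rfl fun t _ => Finset.sum_congr rfl fun j _ => ?_
          congr 1
          ring
    _ = _ := by
        have h1 : ∀ i, ∑ j, (if i = j then (1 : ℝ) else 0) * O j c = O i c := fun i => by simp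
        simp_rw [hBd, h1, hOO, hDR]
        by_cases hac : a = c
        · subst hac
          simp only [if_true, one_smul, Finset.smul_sum, smul_smul]
          have h2 : ∀ e, ∑ t, d t a * O t e = if e = a then ∑ t, O t a * d t a else 0 := fun e =>
            (Finset.sum_congr rfl fun t _ => mul_comm _ _).trans (hdO e a)
          rw [Finset.sum_comm]
          simp_rw [← Finset.sum_smul, h2]
        · simp [hac]

theorem HasStructure.freeCumulantSeries_pair {φ : FreeAlgebra ℝ σ →ₗ[ℝ] ℝ} {b : σ → ℝ}
    (hB : HasStructure φ fun t i j => if i = j then if t = i then b i else 0 else 0)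
    (i j : σ) (w : List σ) : freeCumulantSeries φ (j :: i :: w) =
      if i = j then (1 : NCSeries σ ℝ) w + b i * freeCumulantSeries φ (i :: w) else 0 := by
  have h := congrFun (hB i j) w
  rw [D_apply, D_apply, NCSeries.add_apply, NCSeries.sum_apply] at h
  rw [h]
  split_ifs with hij
  · simp [hij, NCSeries.smul_apply, D_apply]
  · simp [hij, NCSeries.smul_apply, NCSeries.zero_apply]

/-- Distinct first letters give zero at once; equal ones reduce to a shorter word that is still
mixed. -/
theorem HasStructure.freeCumulantSeries_mixed {φ : FreeAlgebra ℝ σ →ₗ[ℝ] ℝ} {b : σ → ℝ}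
    (hB : HasStructure φ fun t i j => if i = j then if t = i then b i else 0 else 0)
    (u : List σ) (hu : ∃ i ∈ u, ∃ j ∈ u, i ≠ j) : freeCumulantSeries φ u = 0 := by
  induction u with
  | nil => simp at hu
  | cons x u ih =>
    cases u with
    | nil => simp at hu
    | cons y w =>
      rw [hB.freeCumulantSeries_pair]
      split_ifs with h
      · subst h
        have hw : w ≠ [] := by
          rintro rfl
          simp at hu
        obtain ⟨z, v, rfl⟩ := List.exists_cons_of_ne_nil hw
        rw [ih (by simpa using hu), one_cons, mul_zero, add_zero]
      · rfl

/-- Coefficients are compared: degrees 0 and 1 need the first two cumulants to vanish, and degree `k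
+ 2` is the recursion. -/
theorem cumulantSeries_eq {ψ : Polynomial ℝ →ₗ[ℝ] ℝ} {b : ℝ}
    (h1 : freeCumulantSeries (oneVar ψ) (List.replicate 1 ()) = 0)
    (h2 : ∀ k, freeCumulantSeries (oneVar ψ) (List.replicate (k + 2) ()) =
      (if k = 0 then 1 else 0) + b * freeCumulantSeries (oneVar ψ) (List.replicate (k + 1) ())) :
    cumulantSeries ψ = PowerSeries.X ^ 2 + PowerSeries.C b * PowerSeries.X * cumulantSeries ψ
      + PowerSeries.C 0 * cumulantSeries ψ ^ 2 := by
  ext k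
  rw [map_zero, zero_mul, add_zero, map_add, mul_assoc, PowerSeries.coeff_C_mul,
    PowerSeries.coeff_X_pow]
  rcases k with _ | _ | k
  · simp [cumulantSeries, freeCumulantSeries_nil]
  · rw [PowerSeries.coeff_succ_X_mul]
    simp only [cumulantSeries, PowerSeries.coeff_mk]
    rw [h1, List.replicate_zero, freeCumulantSeries_nil]
    simp
  · rw [PowerSeries.coeff_succ_X_mul]
    simp only [cumulantSeries, PowerSeries.coeff_mk]
    rw [h2]
    simp

end FreeMeixner

end

/-! ### The free product decomposition -/

theorem proposition4p6 (n : ℕ) (φ : FreeAlgebra ℝ (Fin n) →ₗ[ℝ] ℝ)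
    (hnorm : FreeMeixner.IsNormalized φ)
    (htr : FreeMeixner.IsTracial φ)
    (hM : FreeMeixner.IsFreeMeixnerState φ)
    (B : Fin n → Fin n → Fin n → ℝ)
    (hR : ∀ i j : Fin n,
      NCSeries.D i (NCSeries.D j (FreeMeixner.freeCumulantSeries φ)) =
        (if i = j then 1 else 0) +
          ∑ t, B t i j • NCSeries.D t (FreeMeixner.freeCumulantSeries φ)) :
    ∃ O ∈ Matrix.specialOrthogonalGroup (Fin n) ℝ,
      ∃ ψ : Fin n → Polynomial ℝ →ₗ[ℝ] ℝ,
        (∀ i, FreeMeixner.IsSemicircular (ψ i) ∨ FreeMeixner.IsFreePoisson (ψ i)) ∧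
        FreeMeixner.IsFreeProduct (FreeMeixner.changeVar O φ) ψ := by
  have hB : FreeMeixner.HasStructure φ B := hR
  have rot := hB.rotate hnorm htr
  have rev := hB.reverse hnorm hM
  have s12 : ∀ x y z, B x y z = B y x z := fun x y z => (rot z y x).trans (rev y x z)
  have s23 : ∀ x y z, B x y z = B x z y := fun x y z => (rev z y x).trans (rot x y z)
  obtain ⟨O, hO, d, hd⟩ := Matrix.exists_rotation_simultaneous_diagonal
    (fun t => Matrix.of (B t))
    (fun t => by ext i j; simp [s23 t j i])
    (fun i k => by
      ext a b
      simpa [Matrix.mul_apply] using hB.sum_commute hnorm htr hM i k a b)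
  have hO' := (Matrix.mem_specialOrthogonalGroup_iff.1 hO).1
  obtain ⟨b, hb⟩ := hB.diagonal s12 hO' hd
  have hcum : ∀ (i : Fin n) (k : ℕ),
      FreeMeixner.freeCumulantSeries (FreeMeixner.changeVar O φ) (List.replicate k i) =
        FreeMeixner.freeCumulantSeries (FreeMeixner.oneVar
          (FreeMeixner.distribution φ (∑ j, O j i • FreeAlgebra.ι ℝ j)))
          (List.replicate k ()) := fun i k => by
    rw [FreeMeixner.oneVar_distribution φ fun j => O j i,
      FreeMeixner.freeCumulantSeries_linChange, FreeMeixner.linSubst_replicate O i]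
    exact congrFun (FreeMeixner.freeCumulantSeries_linChange O φ) _
  have hψ : ∀ i, FreeMeixner.IsMeixnerDistribution (b i) 0
      (FreeMeixner.distribution φ (∑ j, O j i • FreeAlgebra.ι ℝ j)) := fun i => by
    refine ⟨hM.1.distribution (FreeMeixner.star_linearForm _), FreeMeixner.cumulantSeries_eq ?_ ?_⟩
    · rw [← hcum]
      have h : FreeMeixner.freeCumulantSeries (FreeMeixner.changeVar O φ) =
        NCSeries.linSubst O _ := FreeMeixner.freeCumulantSeries_linChange O φ
      rw [h, List.replicate_one, NCSeries.linSubst_cons]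
      simp [NCSeries.linSubst_nil, NCSeries.D_apply, hnorm.freeCumulantSeries_singleton]
    · intro k
      rw [← hcum, ← hcum, List.replicate_succ, List.replicate_succ, hb.freeCumulantSeries_pair,
        if_pos rfl]
      cases k <;> rfl
  refine ⟨O, hO, _, fun i => ?_, ?_, hb.freeCumulantSeries_mixed, hcum⟩
  · by_cases h : b i = 0
    · left
      have := hψ i
      rwa [h] at this
    · exact Or.inr ⟨b i, h, hψ i⟩
  · simp [FreeMeixner.changeVar, hM.1.1]
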